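/- Let $G$ be a finite group. Let $\mathrm{Irr}(G)$ be a set of representatives $\rho : G \to U(V_\rho)$ of the isomorphism classes of irreducible complex representations of $G$, chosen unitary on finite-dimensional Hilbert spaces; put $d_\rho = \dim V_\rho$ and $d^0_{\max}(G) = \max_\rho d_\rho$, and for a subgroup $H \le G$ let $I_H(\rho) = \{v \in V_\rho : \rho(h)v = v \text{ for all } h \in H\}$. For $\varepsilon > 0$, an $\varepsilon$-net of $V_\rho$ is a finite set $N$ of unit vectors of $V_\rho$ such that every unit vector $w \in V_\rho$ satisfies $|\langle n, w\rangle|^2 > 1 - \varepsilon^2$ for some $n \in N$. The one-way protocol COMP-REP$(G,\varepsilon)$ is the following. Before receiving their inputs, Alice and Bob agree on an $\varepsilon$-net $N_\rho$ of $V_\rho$ for every $\rho \in \mathrm{Irr}(G)$ and on an injective encoding of the pairs $(\rho, n)$ with $n \in N_\rho$ by bit strings of a fixed length $c$. Alice's input is a subgroup $H \le G$, Bob's input is an element $y \in G$. 1. Alice chooses $\rho \in \mathrm{Irr}(G)$ with probability $|H|\, d_\rho \dim I_H(\rho) / |G|$, and then a uniformly distributed random unit vector $v \in I_H(\rho)$.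 2. Alice sends Bob the encoding of $(\rho, n)$, where $n \in N_\rho$ is a vector of the net closest to $v$, that is, one that maximizes $|\langle n, v\rangle|$ (ties are broken by a fixed measurable rule). 3. Bob outputs $1$ if $|1 - \langle \rho(y) n, n\rangle| \le 2\varepsilon$, and $0$ otherwise. The communication cost is the number $c$ of bits. **Theorem.** There are constants $C > 0$ and $\delta \in (0,1)$ and a polynomial $p$ with coefficients in $\mathbb{N}$ such that for every finite group $G$ the number $\varepsilon_G = 1/p(|G|)$ is well defined and positive, and the following holds for every choice of representatives $\mathrm{Irr}(G)$ as above. * (Correctness) For every choice of the nets, of the tie-breaking rule and of the encoding, the protocol COMP-REP$(G,\varepsilon_G)$ computes the subgroup membership function with perfect completeness and soundness error $\delta$: the messages of Alice have a probability distribution; if $y \in H$, then Bob outputs $1$ with probability $1$; if $y \notin H$, then Bob outputs $0$ with probability at least $1 - \delta$. * (Communication) The nets and the encoding can be chosen so that $c \le C \cdot d^0_{\max}(G) \cdot \log_2 |G|$. -/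

import Mathlib

open MeasureTheory

noncomputable section

namespace CompRep

/-! ### One-way communication protocols -/

/-- A one-way protocol with `c` bits of communication and no shared randomness: on input `x` Alice
draws a bit string of length `c` from the distribution `alice x` and sends it; on input `y` Bob
answers `bob y m` when he receives the message `m`. -/
structure OneWayProtocol (X Y : Type*) (c : ℕ) where
  alice : X → Measure (Fin c → Bool)
  bob : Y → (Fin c → Bool) → Bool

/-- The protocol computes `f` with completeness error `γ` and soundness error `δ`. That the
messages of Alice really have probability distributions is part of the requirement. -/
structure OneWayProtocol.Computes {X Y : Type*} {c : ℕ} (P : OneWayProtocol X Y c)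
    (f : X → Y → Bool) (γ δ : ℝ) : Prop where
  isProbability : ∀ x, IsProbabilityMeasure (P.alice x)
  complete : ∀ x y, f x y = true → 1 - γ ≤ (P.alice x).real {m | P.bob y m = true}
  sound : ∀ x y, f x y = false → 1 - δ ≤ (P.alice x).real {m | P.bob y m = false}

open Classical in
/-- The subgroup membership function. -/
def memb (G : Type*) [Group G] (H : Subgroup G) (y : G) : Bool := decide (y ∈ H)

/-! ### Irreducible complex representations -/

/-- The largest dimension of an irreducible complex representation of `G`. -/
def dMax (G : Type*) [Group G] : ℕ :=
  sSup {d : ℕ | ∃ ρ : Representation ℂ G (Fin d → ℂ), ρ.IsIrreducible}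

/-- An irreducible unitary representation of `G` on a standard finite-dimensional complex Hilbert
space. -/
structure UnitaryIrrep (G : Type*) [Group G] where
  dim : ℕ
  rep : Representation ℂ G (EuclideanSpace ℂ (Fin dim))
  norm_map : ∀ g v, ‖rep g v‖ = ‖v‖
  irreducible : rep.IsIrreducible

/-- The space on which the representation acts. -/
abbrev UnitaryIrrep.Space {G : Type*} [Group G] (σ : UnitaryIrrep G) : Type :=
  EuclideanSpace ℂ (Fin σ.dim)

/-- The subspace of vectors that are fixed by the subgroup `H`. -/
def UnitaryIrrep.fixedSpace {G : Type*} [Group G] (σ : UnitaryIrrep G) (H : Subgroup G) :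
    Submodule ℂ σ.Space :=
  Representation.invariants (σ.rep.comp H.subtype)

/-- Equivalence (isomorphism) of representations. -/
def irrepSetoid (G : Type*) [Group G] : Setoid (UnitaryIrrep G) where
  r σ τ := Nonempty (σ.rep.Equiv τ.rep)
  iseqv :=
    { refl := fun σ => ⟨Representation.Equiv.refl σ.rep⟩
      symm := fun ⟨e⟩ => ⟨e.symm⟩
      trans := fun ⟨e⟩ ⟨f⟩ => ⟨e.trans f⟩ }

/-- The set of isomorphism classes of irreducible complex representations of `G`. -/
def Irr (G : Type*) [Group G] : Type _ := Quotient (irrepSetoid G)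

/-- `R` picks one unitary representative out of every isomorphism class. -/
def IsRepresentatives {G : Type*} [Group G] (R : Irr G → UnitaryIrrep G) : Prop :=
  ∀ i : Irr G, Quotient.mk (irrepSetoid G) (R i) = i

/-! ### Nets and random unit vectors -/

/-- `N` is an `ε`-net of the complex Hilbert space `V`. -/
structure IsEpsNet {V : Type*} [NormedAddCommGroup V] [InnerProductSpace ℂ V] (ε : ℝ)
    (N : Finset V) : Prop where
  unit : ∀ n ∈ N, ‖n‖ = 1
  cover : ∀ w : V, ‖w‖ = 1 → ∃ n ∈ N, 1 - ε ^ 2 < ‖inner ℂ n w‖ ^ 2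

/-- The uniform (rotation invariant) probability distribution on the unit sphere of a nonzero
finite-dimensional complex Hilbert space `W`, as a measure on `W`: the normalized spherical part
of the Haar (Lebesgue) measure. (It is `0` for `W = 0`, where there is no unit vector.) -/
def uniformUnit (W : Type*) [NormedAddCommGroup W] [InnerProductSpace ℂ W]
    [FiniteDimensional ℂ W] [MeasurableSpace W] [BorelSpace W] : Measure W :=
  haveI : ProperSpace W := FiniteDimensional.proper_rclike ℂ W
  let μ : Measure (Metric.sphere (0 : W) 1) := (Measure.addHaar : Measure W).toSphere
  Measure.map (fun v : Metric.sphere (0 : W) 1 => (v : W)) ((μ Set.univ)⁻¹ • μ)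

/-! ### The protocol -/

/-- What Alice and Bob fix before they see their inputs: an `ε`-net `net i` of the space of every
chosen irreducible representation `R i`; a (measurable) rule `near i` that finds a closest net
vector to a given unit vector, where, as in the definition of a net, two unit vectors are the
closer the larger the modulus of their inner product is; and an unambiguous encoding of the pairs
(name of an irreducible representation, vector of its net) by strings of `c` bits. -/
structure Setup {G : Type*} [Group G] (R : Irr G → UnitaryIrrep G) (ε : ℝ) (c : ℕ) where
  net : (i : Irr G) → Finset (R i).Space
  isEpsNet : ∀ i, IsEpsNet ε (net i)
  near : (i : Irr G) → (R i).Space → {n : (R i).Space // n ∈ net i}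
  measurable_near : ∀ i, Measurable (near i)
  near_closest : ∀ i (v : (R i).Space), ‖v‖ = 1 → ∀ n ∈ net i,
    ‖inner ℂ n v‖ ≤ ‖inner ℂ (near i v : (R i).Space) v‖
  encode : ((i : Irr G) × {n : (R i).Space // n ∈ net i}) ↪ (Fin c → Bool)

/-- Alice's message on input `H`: with probability `|H| d_ρ dim I_H(ρ) / |G|` she chooses the
irreducible representation `ρ`; she draws a uniformly random unit vector `v` of the fixed space
`I_H(ρ)`; she sends the encoding of `ρ` and of the net vector closest to `v`. -/
def Setup.alice {G : Type*} [Group G] {R : Irr G → UnitaryIrrep G} {ε : ℝ} {c : ℕ}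
    (S : Setup R ε c) (H : Subgroup G) : Measure (Fin c → Bool) :=
  Measure.sum fun i : Irr G =>
    (((Nat.card H * (R i).dim * Module.finrank ℂ ((R i).fixedSpace H) : ℕ) : ENNReal)
        / (Nat.card G : ENNReal)) •
      Measure.map
        (fun v : (R i).fixedSpace H => S.encode ⟨i, S.near i (v : (R i).Space)⟩)
        (uniformUnit ((R i).fixedSpace H))

open Classical in
/-- Bob's answer on input `y`: he decodes the message to `(ρ, n)` and accepts if and only if
`|1 - ⟨ρ(y) n, n⟩| ≤ 2 ε`. -/
def Setup.bob {G : Type*} [Group G] {R : Irr G → UnitaryIrrep G} {ε : ℝ} {c : ℕ}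
    (S : Setup R ε c) (y : G) (m : Fin c → Bool) : Bool :=
  decide (∃ (i : Irr G) (n : {n : (R i).Space // n ∈ S.net i}), S.encode ⟨i, n⟩ = m ∧
    ‖(1 : ℂ) - inner ℂ ((R i).rep y (n : (R i).Space)) (n : (R i).Space)‖ ≤ 2 * ε)

/-- The protocol `COMP-REP(G, ε)`, for inputs `H` (Alice) and `y` (Bob). -/
def Setup.protocol {G : Type*} [Group G] {R : Irr G → UnitaryIrrep G} {ε : ℝ} {c : ℕ}
    (S : Setup R ε c) : OneWayProtocol (Subgroup G) G c where
  alice := S.alice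
  bob := S.bob

end CompRep

end

/-!
The protocol is correct because of two facts about averages. First, a random unit vector `v` of a
Hilbert space `W` satisfies `E ⟨v, T v⟩ = tr T / dim W`, since its distribution is invariant under
isometries (`finrank_mul_integral_inner_apply`). For `W = I_H(ρ)` and `T` the compression of `ρ(y)`,
the trace is the average of the character of `ρ` over the coset `yH`. Second, the irreducible
characters, weighted by their dimensions, add up to the regular character, which is supported at
the identity (`sum_dim_mul_character`). With the weights of the protocol it follows that
`⟨v, ρ(y) v⟩` has expectation `1` for `y ∈ H` and `0` for `y ∉ H` (`sum_weight_mul_integral`); the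
case `y = 1` shows that the weights add up to `1`.

If `y ∈ H`, then `ρ(y)` fixes `v`, and the net vector `n` passes Bob's test
(`norm_one_sub_inner_le_of_fixed`). If `y ∉ H` and Bob accepts, then `Re ⟨v, ρ(y) v⟩ ≥ 1 - 5 ε`
(`norm_one_sub_inner_le_of_near`). As this real part is at least `-1` and has mean `0`, Markov's
inequality bounds the probability of acceptance by `1 / (2 - 5 ε)`, which is at most `2 / 3` as soon
as `ε ≤ 1 / 10` (`Setup.computes`).

For the communication, rounding coordinates to a grid gives nets with `|G| ^ O(d_ρ)` vectors for
`ε = 1 / (10 |G|)`, and there are at most `|G|` irreducible representations (`exists_setup`).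

The regular character is decomposed by splitting invariant subspaces off the space of functions on
`G` together with their orthogonal complements; the multiplicities are found by the orthogonality of
characters (`exists_regular_decomposition`).
-/

open MeasureTheory

noncomputable section

namespace CompRep

/-! ### Decomposition of unitary representations -/

section Irreps

variable {G : Type*} [Group G]

theorem isIrreducible_iff {k V : Type*} [Field k] [AddCommGroup V] [Module k V]
    (ρ : Representation k G V) :
    ρ.IsIrreducible ↔ Nontrivial V ∧
      ∀ U : Submodule k V, (∀ g, ∀ v ∈ U, ρ g v ∈ U) → U = ⊥ ∨ U = ⊤ := by
  constructor
  · intro h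
    refine ⟨?_, fun U hU => ?_⟩
    · by_contra hV
      rw [not_nontrivial_iff_subsingleton] at hV
      exact bot_ne_top (α := Subrepresentation ρ)
        (Subrepresentation.toSubmodule_injective (Subsingleton.elim _ _))
    · exact (eq_bot_or_eq_top (⟨U, fun g v => hU g v⟩ : Subrepresentation ρ)).imp
        (congrArg Subrepresentation.toSubmodule) (congrArg Subrepresentation.toSubmodule)
  · rintro ⟨hV, h⟩
    have hne : (⊥ : Subrepresentation ρ) ≠ ⊤ := fun he =>
      bot_ne_top (α := Submodule k V) (congrArg Subrepresentation.toSubmodule he)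
    exact
      { exists_pair_ne := ⟨⊥, ⊤, hne⟩
        eq_bot_or_eq_top := fun U =>
          (h U.toSubmodule fun g v hv => U.apply_mem_toSubmodule g hv).imp
            (fun e => Subrepresentation.toSubmodule_injective e)
            (fun e => Subrepresentation.toSubmodule_injective e) }

theorem isIrreducible_of_equiv {k V W : Type*} [Field k] [AddCommGroup V] [Module k V]
    [AddCommGroup W] [Module k W] {ρ : Representation k G V} {σ : Representation k G W}
    (φ : ρ.Equiv σ) (h : ρ.IsIrreducible) : σ.IsIrreducible := by
  rw [isIrreducible_iff] at h ⊢
  obtain ⟨hV, h⟩ := h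
  refine ⟨φ.toLinearEquiv.symm.toEquiv.nontrivial, fun U hU => ?_⟩
  have hφ : ∀ g v, φ.toLinearEquiv (ρ g v) = σ g (φ.toLinearEquiv v) :=
    fun g v => φ.toIntertwiningMap.isIntertwining _ _ g v
  have hmap := U.map_comap_eq_of_surjective (f := φ.toLinearEquiv.toLinearMap)
    φ.toLinearEquiv.surjective
  refine (h (U.comap φ.toLinearEquiv.toLinearMap) fun g v hv => ?_).imp (fun e => ?_) fun e => ?_
  · change φ.toLinearEquiv (ρ g v) ∈ U
    rw [hφ]
    exact hU g _ hv
  · rw [← hmap, e, Submodule.map_bot]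
  · rw [← hmap, e, Submodule.map_top, LinearMap.range_eq_top]
    exact φ.toLinearEquiv.surjective

/-- The representation on `W` that corresponds to `ρ` under a linear isomorphism `V ≃ W`. -/
def transport {k V W : Type*} [Field k] [AddCommGroup V] [Module k V] [AddCommGroup W]
    [Module k W] (e : V ≃ₗ[k] W) (ρ : Representation k G V) : Representation k G W :=
  ((e.conjAlgEquiv k : Module.End k V →* Module.End k W)).comp ρ

theorem transport_apply {k V W : Type*} [Field k] [AddCommGroup V] [Module k V] [AddCommGroup W]
    [Module k W] (e : V ≃ₗ[k] W) (ρ : Representation k G V) (g : G) (w : W) :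
    transport e ρ g w = e (ρ g (e.symm w)) := rfl

/-- A representation is equivalent to its transport. -/
def transportEquiv {k V W : Type*} [Field k] [AddCommGroup V] [Module k V] [AddCommGroup W]
    [Module k W] (e : V ≃ₗ[k] W) (ρ : Representation k G V) : ρ.Equiv (transport e ρ) :=
  .mk e fun g => by
    ext v
    simp [transport_apply]

/-- The character of an irreducible unitary representation. -/
def UnitaryIrrep.character (σ : UnitaryIrrep G) (g : G) : ℂ := σ.rep.character g

theorem UnitaryIrrep.character_one (σ : UnitaryIrrep G) : σ.character 1 = σ.dim := by
  simp [character]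

/-- A finite-dimensional irreducible unitary representation, transported to a standard Hilbert
space by an orthonormal basis. -/
def UnitaryIrrep.ofIsIrreducible {V : Type*} [NormedAddCommGroup V] [InnerProductSpace ℂ V]
    [FiniteDimensional ℂ V] (ρ : Representation ℂ G V) (hρ : ∀ g v, ‖ρ g v‖ = ‖v‖)
    (h : ρ.IsIrreducible) : UnitaryIrrep G where
  dim := Module.finrank ℂ V
  rep := transport (stdOrthonormalBasis ℂ V).repr.toLinearEquiv ρ
  norm_map g v := by simp [transport_apply, hρ]
  irreducible := isIrreducible_of_equiv (transportEquiv _ ρ) h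

theorem UnitaryIrrep.character_ofIsIrreducible {V : Type*} [NormedAddCommGroup V]
    [InnerProductSpace ℂ V] [FiniteDimensional ℂ V] (ρ : Representation ℂ G V)
    (hρ : ∀ g v, ‖ρ g v‖ = ‖v‖) (h : ρ.IsIrreducible) :
    (ofIsIrreducible ρ hρ h).character = ρ.character :=
  (Representation.char_iso (transportEquiv (stdOrthonormalBasis ℂ V).repr.toLinearEquiv ρ)).symm

/-- The linear isometry by which a group element acts in a norm-preserving representation. -/
def isometryOf {V : Type*} [NormedAddCommGroup V] [InnerProductSpace ℂ V]
    (ρ : Representation ℂ G V) (hρ : ∀ g v, ‖ρ g v‖ = ‖v‖) (g : G) : V →ₗᵢ[ℂ] V :=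
  ⟨ρ g, hρ g⟩

theorem inner_map_map {V : Type*} [NormedAddCommGroup V] [InnerProductSpace ℂ V]
    (ρ : Representation ℂ G V) (hρ : ∀ g v, ‖ρ g v‖ = ‖v‖) (g : G) (v w : V) :
    inner ℂ (ρ g v) (ρ g w) = inner ℂ v w :=
  (isometryOf ρ hρ g).inner_map_map v w

theorem inner_map_left {V : Type*} [NormedAddCommGroup V] [InnerProductSpace ℂ V]
    (ρ : Representation ℂ G V) (hρ : ∀ g v, ‖ρ g v‖ = ‖v‖) (g : G) (v w : V) :
    inner ℂ (ρ g v) w = inner ℂ v (ρ g⁻¹ w) := by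
  rw [← inner_map_map ρ hρ g v, ρ.self_inv_apply]

/-- The trace of a map that leaves a subspace and its orthogonal complement invariant is the sum of
the two traces. -/
theorem trace_eq_add_orthogonal {V : Type*} [NormedAddCommGroup V] [InnerProductSpace ℂ V]
    [FiniteDimensional ℂ V] (U : Submodule ℂ V) (T : V →ₗ[ℂ] V) (h : ∀ v ∈ U, T v ∈ U)
    (h' : ∀ v ∈ Uᗮ, T v ∈ Uᗮ) :
    LinearMap.trace ℂ V T =
      LinearMap.trace ℂ U (T.restrict h) + LinearMap.trace ℂ Uᗮ (T.restrict h') := by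
  have hi : DirectSum.IsInternal (fun b : Bool => bif b then U else Uᗮ) := by
    rw [DirectSum.isInternal_submodule_iff_isCompl _ (i := true) (j := false) (by simp)
      (by ext b; cases b <;> simp)]
    exact U.isCompl_orthogonal
  rw [LinearMap.trace_eq_sum_trace_restrict hi (f := T) (by rintro (_ | _) <;> assumption)]
  simp only [Fintype.sum_bool]
  rfl

/-- Complete reducibility: a norm-preserving representation decomposes into irreducible ones,
which are split off one at a time with their orthogonal complements. -/
theorem exists_character_eq_sum {V : Type*} [NormedAddCommGroup V] [InnerProductSpace ℂ V]
    [FiniteDimensional ℂ V] (ρ : Representation ℂ G V) (hρ : ∀ g v, ‖ρ g v‖ = ‖v‖) :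
    ∃ (κ : Type) (_ : Fintype κ) (τ : κ → UnitaryIrrep G),
      ∀ g, ρ.character g = ∑ k, (τ k).character g := by
  induction hn : Module.finrank ℂ V using Nat.strong_induction_on generalizing V with
  | _ n ih =>
  rcases subsingleton_or_nontrivial V with hV | hV
  · refine ⟨Empty, inferInstance, Empty.elim, fun g => ?_⟩
    rw [Representation.character, Subsingleton.elim (ρ g) 0]
    simp
  by_cases hirr : ρ.IsIrreducible
  · refine ⟨Unit, inferInstance, fun _ => .ofIsIrreducible ρ hρ hirr, fun g => ?_⟩
    simp [UnitaryIrrep.character_ofIsIrreducible]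
  · simp only [isIrreducible_iff, hV, true_and, not_forall, not_or] at hirr
    obtain ⟨U, hU, hbot, htop⟩ := hirr
    have hU' : ∀ g, ∀ v ∈ Uᗮ, ρ g v ∈ Uᗮ := fun g v hv u hu => by
      rw [← inner_conj_symm, inner_map_left ρ hρ, inner_conj_symm]
      exact hv _ (hU _ u hu)
    have h1 : Module.finrank ℂ U < n := hn ▸ Submodule.finrank_lt htop
    have h2 : Module.finrank ℂ Uᗮ < n := by
      have := U.finrank_add_finrank_orthogonal
      have : Module.finrank ℂ U ≠ 0 := fun h => hbot (Submodule.finrank_eq_zero.1 h)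
      omega
    obtain ⟨κ, _, τ, hτ⟩ := ih _ h1 (⟨U, fun g v => hU g v⟩ : Subrepresentation ρ).toRepresentation
      (fun g v => hρ g v) rfl
    obtain ⟨κ', _, τ', hτ'⟩ := ih _ h2
      (⟨Uᗮ, fun g v => hU' g v⟩ : Subrepresentation ρ).toRepresentation (fun g v => hρ g v) rfl
    refine ⟨κ ⊕ κ', inferInstance, Sum.elim τ τ', fun g => ?_⟩
    rw [Fintype.sum_sum_type]
    simp only [Sum.elim_inl, Sum.elim_inr]
    rw [← hτ, ← hτ', Representation.character, trace_eq_add_orthogonal U (ρ g) (hU g) (hU' g)]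
    rfl

/-! ### The regular representation -/

/-- The left regular representation, on the Hilbert space of functions on the group. -/
def regular (G : Type*) [Group G] [Fintype G] : Representation ℂ G (EuclideanSpace ℂ G) where
  toFun g := (LinearIsometryEquiv.piLpCongrLeft 2 ℂ ℂ (Equiv.mulLeft g)).toLinearEquiv.toLinearMap
  map_one' := by
    ext f x
    simp only [LinearEquiv.coe_coe, LinearIsometryEquiv.coe_toLinearEquiv,
      LinearIsometryEquiv.piLpCongrLeft_apply, Equiv.piCongrLeft'_apply, Equiv.mulLeft_symm]
    simp
  map_mul' g h := by
    ext f x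
    simp only [LinearEquiv.coe_coe, LinearIsometryEquiv.coe_toLinearEquiv, Module.End.mul_apply,
      LinearIsometryEquiv.piLpCongrLeft_apply, Equiv.piCongrLeft'_apply, Equiv.mulLeft_symm]
    simp

theorem character_regular [Fintype G] [DecidableEq G] (g : G) :
    (regular G).character g = if g = 1 then (Nat.card G : ℂ) else 0 := by
  rw [Representation.character,
    LinearMap.trace_eq_sum_inner _ (EuclideanSpace.basisFun G ℂ)]
  have h : ∀ x : G, inner ℂ (EuclideanSpace.basisFun G ℂ x)
      (regular G g (EuclideanSpace.basisFun G ℂ x)) = if g = 1 then 1 else 0 := fun x => by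
    simp [regular, EuclideanSpace.inner_single_left, PiLp.single_apply]
  simp only [h]
  split_ifs <;> simp

theorem norm_regular [Fintype G] (g : G) (f : EuclideanSpace ℂ G) :
    ‖regular G g f‖ = ‖f‖ :=
  (LinearIsometryEquiv.piLpCongrLeft 2 ℂ ℂ (Equiv.mulLeft g)).norm_map f

open Classical in
/-- The regular representation decomposes into irreducible ones, and by the orthogonality of
characters every irreducible representation occurs as often as its dimension says. -/
theorem exists_regular_decomposition (G : Type*) [Group G] [Finite G] :
    ∃ (κ : Type) (_ : Fintype κ) (τ : κ → UnitaryIrrep G),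
      (∀ g, ∑ k, (τ k).character g = if g = 1 then (Nat.card G : ℂ) else 0) ∧
      ∀ σ : UnitaryIrrep G,
        σ.dim = (Finset.univ.filter fun k => Nonempty (σ.rep.Equiv (τ k).rep)).card := by
  have := Fintype.ofFinite G
  obtain ⟨κ, _, τ, hτ⟩ := exists_character_eq_sum (regular G) norm_regular
  simp only [character_regular] at hτ
  refine ⟨κ, inferInstance, τ, fun g => (hτ g).symm, fun σ => ?_⟩
  have hG : (Nat.card G : ℂ) ≠ 0 := Nat.cast_ne_zero.2 Nat.card_pos.ne'
  have := invertibleOfNonzero hG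
  have horth : ∀ k, (Nat.card G : ℂ)⁻¹ * ∑ g : G, (τ k).character g * σ.character g⁻¹ =
      if Nonempty (σ.rep.Equiv (τ k).rep) then 1 else 0 := fun k => by
    have := (τ k).irreducible
    have := σ.irreducible
    exact Representation.char_orthonormal (τ k).rep σ.rep
  -- sum over the constituents: by linearity, the regular character is paired with that of `σ`
  have hsum := Finset.sum_congr (rfl : (Finset.univ : Finset κ) = _) fun k _ => horth k
  rw [← Finset.mul_sum, Finset.sum_comm] at hsum
  simp only [← Finset.sum_mul, ← hτ, ite_mul, zero_mul, Finset.sum_ite_eq', Finset.mem_univ,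
    if_true, inv_one, σ.character_one, Finset.sum_boole, inv_mul_cancel_left₀ hG] at hsum
  exact_mod_cast hsum

theorem UnitaryIrrep.dim_pos (σ : UnitaryIrrep G) : 0 < σ.dim := by
  have := ((isIrreducible_iff σ.rep).1 σ.irreducible).1
  by_contra h
  obtain ⟨d, rep, hn, hi⟩ := σ
  obtain rfl : d = 0 := by simpa using h
  exact not_subsingleton (EuclideanSpace ℂ (Fin 0)) inferInstance

/-- The constituents of the regular representation exhaust the irreducible representations, and
there are at most `|G|` of them because their dimensions add up to `|G|`. -/
theorem exists_surjective_irr (G : Type*) [Group G] [Finite G] :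
    ∃ (κ : Type) (_ : Fintype κ) (f : κ → Irr G), Function.Surjective f ∧
      Fintype.card κ ≤ Nat.card G := by
  classical
  obtain ⟨κ, _, τ, hτ, hdim⟩ := exists_regular_decomposition G
  refine ⟨κ, inferInstance, fun k => Quotient.mk _ (τ k), fun i => ?_, ?_⟩
  · induction i using Quotient.inductionOn with
    | _ σ =>
    have h := σ.dim_pos
    rw [hdim σ, Finset.card_pos] at h
    obtain ⟨k, hk⟩ := h
    exact ⟨k, (Quotient.sound (Finset.mem_filter.1 hk).2).symm⟩
  · have h := hτ 1
    simp only [UnitaryIrrep.character_one, if_true] at h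
    have h' : ∑ k, (τ k).dim = Nat.card G := by exact_mod_cast h
    rw [← h', ← Finset.card_univ, Finset.card_eq_sum_ones]
    exact Finset.sum_le_sum fun k _ => (τ k).dim_pos

instance finite_irr (G : Type*) [Group G] [Finite G] : Finite (Irr G) := by
  obtain ⟨κ, _, f, hf, -⟩ := exists_surjective_irr G
  exact Finite.of_surjective f hf

theorem card_irr_le (G : Type*) [Group G] [Finite G] : Nat.card (Irr G) ≤ Nat.card G := by
  obtain ⟨κ, _, f, hf, h⟩ := exists_surjective_irr G
  exact (Nat.card_le_card_of_surjective f hf).trans (by rwa [Nat.card_eq_fintype_card])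

/-- The character of the regular representation is the sum of the irreducible characters,
weighted by their dimensions. -/
theorem sum_dim_mul_character [Finite G] [Fintype (Irr G)] {R : Irr G → UnitaryIrrep G}
    (hR : IsRepresentatives R) [DecidableEq G] (g : G) :
    ∑ i, ((R i).dim : ℂ) * (R i).character g = if g = 1 then (Nat.card G : ℂ) else 0 := by
  classical
  obtain ⟨κ, _, τ, hτ, hdim⟩ := exists_regular_decomposition G
  let cl : κ → Irr G := fun k => Quotient.mk (irrepSetoid G) (τ k)
  have hcl : ∀ i k, cl k = i ↔ Nonempty ((R i).rep.Equiv (τ k).rep) := fun i k => by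
    have h : cl k = i ↔ Quotient.mk (irrepSetoid G) (R i) = Quotient.mk (irrepSetoid G) (τ k) :=
      ⟨fun e => (hR i).trans e.symm, fun e => e.symm.trans (hR i)⟩
    exact h.trans Quotient.eq
  rw [show (if g = 1 then (Nat.card G : ℂ) else 0) = ∑ k, (τ k).character g by
      rw [hτ]; congr,
    ← Finset.sum_fiberwise Finset.univ cl]
  refine Finset.sum_congr rfl fun i _ => ?_
  rw [hdim (R i), ← nsmul_eq_mul, ← Finset.sum_const]
  simp only [hcl]
  refine Finset.sum_congr rfl fun k hk => ?_
  obtain ⟨φ⟩ := (Finset.mem_filter.1 hk).2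
  exact congrFun (Representation.char_iso φ) g

theorem finrank_le_card_of_isIrreducible [Finite G] {k V : Type*} [Field k] [AddCommGroup V]
    [Module k V] (ρ : Representation k G V) (h : ρ.IsIrreducible) :
    Module.finrank k V ≤ Nat.card G := by
  have := Fintype.ofFinite G
  obtain ⟨hV, h⟩ := (isIrreducible_iff ρ).1 h
  obtain ⟨v, hv⟩ := exists_ne (0 : V)
  -- the orbit of a nonzero vector spans a nonzero invariant subspace
  have hspan := h (Submodule.span k (Set.range fun g => ρ g v)) fun g w hw => by
    induction hw using Submodule.span_induction with
    | mem w hw =>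
      obtain ⟨x, rfl⟩ := hw
      exact Submodule.subset_span ⟨g * x, by simp⟩
    | zero => simp
    | add x y _ _ hx hy => simpa using add_mem hx hy
    | smul a x _ hx => simpa using Submodule.smul_mem _ a hx
  have hmem : v ∈ Submodule.span k (Set.range fun g => ρ g v) :=
    Submodule.subset_span ⟨1, by simp⟩
  rcases hspan with hs | hs
  · rw [hs, Submodule.mem_bot] at hmem
    exact absurd hmem hv
  · rw [← finrank_top, ← hs, Nat.card_eq_fintype_card]
    exact finrank_range_le_card _

theorem UnitaryIrrep.dim_le_card [Finite G] (σ : UnitaryIrrep G) : σ.dim ≤ Nat.card G := by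
  simpa using finrank_le_card_of_isIrreducible σ.rep σ.irreducible

theorem UnitaryIrrep.dim_le_dMax [Finite G] (σ : UnitaryIrrep G) : σ.dim ≤ dMax G := by
  refine le_csSup ⟨Nat.card G, ?_⟩ ?_
  · rintro d ⟨ρ, hρ⟩
    simpa using finrank_le_card_of_isIrreducible ρ hρ
  · exact ⟨_, isIrreducible_of_equiv
      (transportEquiv (WithLp.linearEquiv 2 ℂ (Fin σ.dim → ℂ)) σ.rep) σ.irreducible⟩

end Irreps

/-! ### The uniform distribution on the unit sphere -/

section Sphere

variable {W : Type*} [NormedAddCommGroup W] [InnerProductSpace ℂ W] [FiniteDimensional ℂ W]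
  [MeasurableSpace W] [BorelSpace W]

open scoped Pointwise in
theorem uniformUnit_apply [ProperSpace W] {s : Set W} (hs : MeasurableSet s) :
    uniformUnit W s = ((Measure.addHaar : Measure W).toSphere Set.univ)⁻¹ *
      (Module.finrank ℝ W * (Measure.addHaar : Measure W)
        (Set.Ioo (0 : ℝ) 1 • (Metric.sphere (0 : W) 1 ∩ s))) := by
  rw [uniformUnit, Measure.map_apply measurable_subtype_coe hs]
  simp only [Measure.smul_apply, smul_eq_mul]
  rw [Measure.toSphere_apply' _ (measurable_subtype_coe hs), Subtype.image_preimage_coe]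

instance isProbabilityMeasure_uniformUnit [Nontrivial W] :
    IsProbabilityMeasure (uniformUnit W) := by
  have : ProperSpace W := FiniteDimensional.proper_rclike ℂ W
  have : FiniteDimensional ℝ W := FiniteDimensional.complexToReal W
  refine ⟨?_⟩
  rw [uniformUnit, Measure.map_apply measurable_subtype_coe .univ]
  simp only [Measure.smul_apply, smul_eq_mul, Set.preimage_univ]
  refine ENNReal.inv_mul_cancel ?_ (measure_ne_top _ _)
  rw [Ne, Measure.measure_univ_eq_zero]
  exact Measure.toSphere_ne_zero _

theorem ae_norm_eq_one_uniformUnit : ∀ᵐ v ∂(uniformUnit W), ‖v‖ = 1 := by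
  rw [uniformUnit, ae_map_iff measurable_subtype_coe.aemeasurable
    (measurableSet_eq_fun measurable_norm measurable_const)]
  exact Filter.Eventually.of_forall fun v => by simp

omit [FiniteDimensional ℂ W] in
theorem measurePreserving_addHaar_linearIsometryEquiv [FiniteDimensional ℝ W] [ProperSpace W]
    (e : W ≃ₗᵢ[ℂ] W) :
    MeasurePreserving e (Measure.addHaar : Measure W) Measure.addHaar := by
  refine ⟨e.continuous.measurable, ?_⟩
  set μ : Measure W := Measure.addHaar
  have : (μ.map e).IsAddHaarMeasure :=
    e.toLinearEquiv.toAddEquiv.isAddHaarMeasure_map μ e.continuous e.symm.continuous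
  have h := Measure.isAddLeftInvariant_eq_smul (μ.map e) μ
  -- the unit ball has the same volume for both Haar measures, so the factor between them is `1`
  have hb : μ.map e (Metric.ball 0 1) = μ (Metric.ball 0 1) := by
    rw [Measure.map_apply e.continuous.measurable Metric.isOpen_ball.measurableSet,
      e.preimage_ball, map_zero]
  have h0 : μ (Metric.ball 0 1) ≠ 0 := (Metric.measure_ball_pos μ 0 one_pos).ne'
  have h1 : μ (Metric.ball 0 1) ≠ ⊤ := measure_ball_lt_top.ne
  have hc : (Measure.addHaarScalarFactor (μ.map e) μ : ENNReal) = 1 := by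
    rw [h, Measure.smul_apply] at hb
    exact (ENNReal.mul_eq_right h0 h1).1 hb
  rw [h]
  ext s _
  rw [Measure.smul_apply]
  change (Measure.addHaarScalarFactor (μ.map e) μ : ENNReal) * _ = _
  rw [hc, one_mul]

open scoped Pointwise in
theorem measurePreserving_uniformUnit (e : W ≃ₗᵢ[ℂ] W) :
    MeasurePreserving e (uniformUnit W) (uniformUnit W) := by
  have : ProperSpace W := FiniteDimensional.proper_rclike ℂ W
  have : FiniteDimensional ℝ W := FiniteDimensional.complexToReal W
  refine ⟨e.continuous.measurable, ?_⟩
  ext s hs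
  rw [Measure.map_apply e.continuous.measurable hs,
    uniformUnit_apply (e.continuous.measurable hs), uniformUnit_apply hs]
  congr 2
  conv_rhs => rw [← (measurePreserving_addHaar_linearIsometryEquiv e).measure_preimage_equiv
    (f := e.toHomeomorph.toMeasurableEquiv)]
  congr 1
  ext v
  simp only [Set.mem_smul, Set.mem_preimage, Set.mem_inter_iff, mem_sphere_zero_iff_norm]
  constructor
  · rintro ⟨r, hr, w, ⟨hw, hws⟩, rfl⟩
    exact ⟨r, hr, e w, ⟨by simpa using hw, hws⟩, by
      change r • e w = e (r • w)
      exact (map_real_smul e e.continuous r w).symm⟩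
  · rintro ⟨r, hr, w, ⟨hw, hws⟩, h⟩
    refine ⟨r, hr, e.symm w, ⟨by simpa using hw, by simpa using hws⟩, ?_⟩
    apply e.injective
    rw [map_real_smul e e.continuous, e.apply_symm_apply]
    exact h

theorem integrable_uniformUnit [Nontrivial W] {f : W → ℂ} (hf : Continuous f) (C : ℝ)
    (h : ∀ v : W, ‖v‖ = 1 → ‖f v‖ ≤ C) : Integrable f (uniformUnit W) :=
  Integrable.of_bound hf.aestronglyMeasurable C
    (ae_norm_eq_one_uniformUnit.mono fun v hv => h v hv)

theorem integrable_coord_mul_coord [Nontrivial W] {ι : Type*} [Fintype ι]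
    (b : OrthonormalBasis ι ℂ W) (i j : ι) :
    Integrable (fun v => inner ℂ v (b i) * inner ℂ (b j) v) (uniformUnit W) := by
  refine integrable_uniformUnit (by fun_prop) 1 fun v hv => ?_
  rw [norm_mul]
  have h1 := norm_inner_le_norm (𝕜 := ℂ) v (b i)
  have h2 := norm_inner_le_norm (𝕜 := ℂ) (b j) v
  rw [hv, b.norm_eq_one, one_mul] at h1 h2
  nlinarith [norm_nonneg (inner ℂ v (b i)), norm_nonneg (inner ℂ (b j) v)]

/-- The coordinates of a random unit vector are uncorrelated: the distribution is invariant under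
the change of sign of one coordinate. -/
theorem integral_coord_mul_coord_of_ne {ι : Type*} [Fintype ι]
    (b : OrthonormalBasis ι ℂ W) {i j : ι} (hij : i ≠ j) :
    ∫ v, inner ℂ v (b i) * inner ℂ (b j) v ∂(uniformUnit W) = 0 := by
  let e := (ℂ ∙ b i).reflection
  have h := (measurePreserving_uniformUnit e).integral_comp e.toHomeomorph.measurableEmbedding
    (fun v => inner ℂ v (b i) * inner ℂ (b j) v)
  have hi : e (b i) = b i :=
    Submodule.reflection_mem_subspace_eq_self (Submodule.mem_span_singleton_self _)
  have hj : e (b j) = -b j := Submodule.reflection_mem_subspace_orthogonalComplement_eq_neg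
    (Submodule.mem_orthogonal_singleton_iff_inner_right.2 (b.orthonormal.2 hij))
  have hs : ∀ v, inner ℂ (e v) (b i) * inner ℂ (b j) (e v) =
      -(inner ℂ v (b i) * inner ℂ (b j) v) := fun v => by
    have h1 : inner ℂ (e v) (b i) = inner ℂ v (b i) := by
      rw [← e.inner_map_map v (b i), hi]
    have h2 : inner ℂ (b j) (e v) = -inner ℂ (b j) v := by
      rw [← e.inner_map_map (b j) v, hj, inner_neg_left, neg_neg]
    rw [h1, h2, mul_neg]
  simp only [hs, integral_neg] at h
  exact self_eq_neg.1 h.symm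

/-- The coordinates of a random unit vector have the same second moment: the distribution is
invariant under permutations of the coordinates. -/
theorem integral_coord_mul_coord_self_eq {ι : Type*} [Fintype ι]
    (b : OrthonormalBasis ι ℂ W) (i j : ι) :
    ∫ v, inner ℂ v (b i) * inner ℂ (b i) v ∂(uniformUnit W) =
      ∫ v, inner ℂ v (b j) * inner ℂ (b j) v ∂(uniformUnit W) := by
  classical
  let e := b.equiv b (Equiv.swap i j)
  have h := (measurePreserving_uniformUnit e).integral_comp e.toHomeomorph.measurableEmbedding
    (fun v => inner ℂ v (b j) * inner ℂ (b j) v)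
  have hi : e (b i) = b j := by simp [e]
  rw [← h]
  congr 1
  ext v
  rw [← hi, e.inner_map_map, e.inner_map_map]

theorem integral_coord_mul_coord_self [Nontrivial W] {ι : Type*} [Fintype ι]
    (b : OrthonormalBasis ι ℂ W) (i : ι) :
    (Module.finrank ℂ W : ℂ) * ∫ v, inner ℂ v (b i) * inner ℂ (b i) v ∂(uniformUnit W) = 1 := by
  have h : ∑ j, ∫ v, inner ℂ v (b j) * inner ℂ (b j) v ∂(uniformUnit W) = 1 := by
    rw [← integral_finsetSum _ fun j _ => integrable_coord_mul_coord b j j]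
    rw [integral_congr_ae (g := fun _ => (1 : ℂ))]
    · simp
    · filter_upwards [ae_norm_eq_one_uniformUnit (W := W)] with v hv
      rw [b.sum_inner_mul_inner, inner_self_eq_norm_sq_to_K, hv]
      simp
  rw [Finset.sum_congr rfl fun j _ => integral_coord_mul_coord_self_eq b j i] at h
  rw [Finset.sum_const, nsmul_eq_mul, Finset.card_univ, ← Module.finrank_eq_card_basis b.toBasis]
    at h
  exact h

/-- The expectation of a quadratic form at a random unit vector is its normalized trace. -/
theorem finrank_mul_integral_inner_apply [Nontrivial W] (T : W →ₗ[ℂ] W) :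
    (Module.finrank ℂ W : ℂ) * ∫ v, inner ℂ v (T v) ∂(uniformUnit W) = LinearMap.trace ℂ W T := by
  let b := stdOrthonormalBasis ℂ W
  have hexp : ∀ v, inner ℂ v (T v) = ∑ i, ∑ j,
      inner ℂ (b i) (T (b j)) * (inner ℂ v (b i) * inner ℂ (b j) v) := fun v => by
    rw [← b.sum_inner_mul_inner v (T v)]
    refine Finset.sum_congr rfl fun i _ => ?_
    conv_lhs => rw [← b.sum_repr' v, map_sum, inner_sum, Finset.mul_sum]
    refine Finset.sum_congr rfl fun j _ => ?_
    rw [map_smul, inner_smul_right, b.sum_repr' v]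
    ring
  simp only [hexp]
  rw [integral_finsetSum _ fun i _ => integrable_finsetSum _ fun j _ =>
    (integrable_coord_mul_coord b i j).const_mul _]
  rw [LinearMap.trace_eq_sum_inner T b, Finset.mul_sum]
  refine Finset.sum_congr rfl fun i _ => ?_
  rw [integral_finsetSum _ fun j _ => (integrable_coord_mul_coord b i j).const_mul _,
    Finset.sum_eq_single i]
  · rw [integral_const_mul, mul_left_comm, integral_coord_mul_coord_self, mul_one]
  · intro j _ hj
    rw [integral_const_mul, integral_coord_mul_coord_of_ne b hj.symm, mul_zero]
  · simp

end Sphere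

/-! ### Replacing a vector by a nearby net vector -/

section Near

variable {G : Type*} [Group G] {V : Type*} [NormedAddCommGroup V] [InnerProductSpace ℂ V]

theorem inner_sub_smul_self {n v : V} (hv : ‖v‖ = 1) :
    inner ℂ v (n - inner ℂ v n • v) = 0 := by
  rw [inner_sub_right, inner_smul_right, inner_self_eq_norm_sq_to_K, hv]
  simp

theorem norm_sub_smul_sq {n v : V} (hn : ‖n‖ = 1) (hv : ‖v‖ = 1) :
    ‖n - inner ℂ v n • v‖ ^ 2 = 1 - ‖inner ℂ n v‖ ^ 2 := by
  have h := norm_add_sq_eq_norm_sq_add_norm_sq_of_inner_eq_zero (𝕜 := ℂ)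
    (inner ℂ v n • v) (n - inner ℂ v n • v)
    (by rw [inner_smul_left, inner_sub_smul_self hv, mul_zero])
  rw [add_sub_cancel, hn, norm_smul, hv, ← norm_inner_symm n v] at h
  nlinarith

/-- Completeness of the test: for a fixed vector `v`, the part of `n` along `v` contributes
`‖⟨n, v⟩‖ ^ 2` to `⟨ρ(y) n, n⟩`, and the orthogonal part at most `1 - ‖⟨n, v⟩‖ ^ 2`. -/
theorem norm_one_sub_inner_le_of_fixed (ρ : Representation ℂ G V) (hρ : ∀ g v, ‖ρ g v‖ = ‖v‖)
    {y : G} {n v : V} (hn : ‖n‖ = 1) (hv : ‖v‖ = 1) (hy : ρ y v = v) {ε : ℝ} (hε : ε ≤ 1)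
    (hε0 : 0 ≤ ε) (h : 1 - ε ^ 2 < ‖inner ℂ n v‖ ^ 2) :
    ‖(1 : ℂ) - inner ℂ (ρ y n) n‖ ≤ 2 * ε := by
  set a : ℂ := inner ℂ v n with ha
  set w : V := n - a • v with hw
  have hvw : inner ℂ v w = 0 := inner_sub_smul_self hv
  have hw2 : ‖w‖ ^ 2 = 1 - ‖inner ℂ n v‖ ^ 2 := norm_sub_smul_sq hn hv
  have hna : n = a • v + w := by rw [hw]; abel
  have hyw : inner ℂ (ρ y w) v = 0 := by
    rw [← hy, inner_map_map ρ hρ, ← inner_conj_symm, hvw, map_zero]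
  have key : inner ℂ (ρ y n) n = (‖inner ℂ n v‖ ^ 2 : ℝ) + inner ℂ (ρ y w) w := by
    have h1 : inner ℂ (ρ y n) n = inner ℂ (a • v + ρ y w) (a • v + w) := by
      conv_lhs => rw [hna, map_add, map_smul, hy]
    rw [h1, inner_add_left, inner_add_right, inner_add_right, inner_smul_left, inner_smul_left,
      inner_smul_right, inner_smul_right, hvw, hyw, inner_self_eq_norm_sq_to_K, hv,
      norm_inner_symm n v, ← ha, Complex.ofReal_pow, ← Complex.conj_mul']
    simp
  have h2 : (1 : ℂ) - inner ℂ (ρ y n) n = (‖w‖ ^ 2 : ℝ) - inner ℂ (ρ y w) w := by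
    rw [key, hw2]; push_cast; ring
  have h3 : ‖inner ℂ (ρ y w) w‖ ≤ ‖w‖ ^ 2 := by
    have := norm_inner_le_norm (𝕜 := ℂ) (ρ y w) w
    rwa [hρ, ← sq] at this
  calc ‖(1 : ℂ) - inner ℂ (ρ y n) n‖ ≤ ‖((‖w‖ ^ 2 : ℝ) : ℂ)‖ + ‖inner ℂ (ρ y w) w‖ := by
        rw [h2]; exact norm_sub_le _ _
    _ ≤ ‖w‖ ^ 2 + ‖w‖ ^ 2 := by
        rw [Complex.norm_real, Real.norm_of_nonneg (sq_nonneg _)]; gcongr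
    _ ≤ 2 * ε := by nlinarith

/-- Soundness of the test: if the net vector `n` passes, then `v` passes with a weaker
threshold. -/
theorem norm_one_sub_inner_le_of_near (ρ : Representation ℂ G V) (hρ : ∀ g v, ‖ρ g v‖ = ‖v‖)
    {y : G} {n v : V} (hn : ‖n‖ = 1) (hv : ‖v‖ = 1) {ε : ℝ} (hε : ε ≤ 1)
    (hε0 : 0 ≤ ε) (h : 1 - ε ^ 2 < ‖inner ℂ n v‖ ^ 2)
    (hb : ‖(1 : ℂ) - inner ℂ (ρ y n) n‖ ≤ 2 * ε) :
    ‖(1 : ℂ) - inner ℂ (ρ y v) v‖ ≤ 5 * ε := by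
  set a : ℂ := inner ℂ v n with ha
  set w : V := n - a • v with hw
  have hw2 : ‖w‖ ^ 2 = 1 - ‖inner ℂ n v‖ ^ 2 := norm_sub_smul_sq hn hv
  have hwε : ‖w‖ ≤ ε := abs_le_of_sq_le_sq' (by linarith) hε0 |>.2
  have ha1 : ‖a‖ ≤ 1 := by
    have := norm_inner_le_norm (𝕜 := ℂ) v n
    rwa [hn, hv, one_mul] at this
  have hna : n = a • v + w := by rw [hw]; abel
  have key : inner ℂ (ρ y n) n - inner ℂ (ρ y v) v =
      inner ℂ (ρ y n) w + a * inner ℂ (ρ y w) v - (‖w‖ ^ 2 : ℝ) * inner ℂ (ρ y v) v := by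
    have h1 : inner ℂ (ρ y n) n = inner ℂ (ρ y n) w + a * inner ℂ (ρ y n) v := by
      conv_lhs => rw [hna]
      rw [inner_add_right, inner_smul_right, ← hna, add_comm]
    have h2 : inner ℂ (ρ y n) v = (starRingEnd ℂ) a * inner ℂ (ρ y v) v + inner ℂ (ρ y w) v := by
      conv_lhs => rw [hna]
      rw [map_add, map_smul, inner_add_left, inner_smul_left]
    have h3 : ((‖w‖ ^ 2 : ℝ) : ℂ) = 1 - a * (starRingEnd ℂ) a := by
      rw [hw2, norm_inner_symm n v, ← ha, Complex.mul_conj']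
      push_cast
      ring
    rw [h1, h2, h3]
    ring
  have h1 : ‖inner ℂ (ρ y n) w‖ ≤ ε := by
    have := norm_inner_le_norm (𝕜 := ℂ) (ρ y n) w
    rw [hρ, hn, one_mul] at this
    exact this.trans hwε
  have h2 : ‖a * inner ℂ (ρ y w) v‖ ≤ ε := by
    have := norm_inner_le_norm (𝕜 := ℂ) (ρ y w) v
    rw [hρ, hv, mul_one] at this
    rw [norm_mul]
    exact (mul_le_of_le_one_left (norm_nonneg _) ha1).trans (this.trans hwε)
  have h3 : ‖((‖w‖ ^ 2 : ℝ) : ℂ) * inner ℂ (ρ y v) v‖ ≤ ε := by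
    have := norm_inner_le_norm (𝕜 := ℂ) (ρ y v) v
    rw [hρ, hv, one_mul] at this
    rw [norm_mul, Complex.norm_real, Real.norm_of_nonneg (sq_nonneg _)]
    exact (mul_le_of_le_one_right (sq_nonneg _) this).trans (by nlinarith [norm_nonneg w])
  calc ‖(1 : ℂ) - inner ℂ (ρ y v) v‖
      = ‖((1 : ℂ) - inner ℂ (ρ y n) n) + (inner ℂ (ρ y n) n - inner ℂ (ρ y v) v)‖ := by
        congr 1; ring
    _ ≤ 2 * ε + (ε + ε + ε) := by
        rw [key]
        refine (norm_add_le _ _).trans (add_le_add hb ?_)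
        refine (norm_sub_le _ _).trans (add_le_add ((norm_add_le _ _).trans ?_) h3)
        exact add_le_add h1 h2
    _ = 5 * ε := by ring

end Near

/-! ### The expectation of the test -/

section Expectation

variable {G : Type*} [Group G]

theorem UnitaryIrrep.mem_fixedSpace {σ : UnitaryIrrep G} {H : Subgroup G} {v : σ.Space} :
    v ∈ σ.fixedSpace H ↔ ∀ h ∈ H, σ.rep h v = v :=
  ⟨fun hv h hh => hv ⟨h, hh⟩, fun hv h => hv h h.2⟩

/-- The sum of the operators of a subgroup is `|H|` times the projection to its fixed space. -/
def UnitaryIrrep.sumMap (σ : UnitaryIrrep G) (H : Subgroup G) [Fintype H] :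
    σ.Space →ₗ[ℂ] σ.fixedSpace H :=
  (∑ h : H, σ.rep h).codRestrict _ fun v => UnitaryIrrep.mem_fixedSpace.2 fun g hg => by
    rw [LinearMap.sum_apply, map_sum]
    refine Fintype.sum_equiv (Equiv.mulLeft ⟨g, hg⟩) _ _ fun h => ?_
    simp

theorem UnitaryIrrep.coe_sumMap (σ : UnitaryIrrep G) (H : Subgroup G) [Fintype H] (v : σ.Space) :
    (σ.sumMap H v : σ.Space) = ∑ h : H, σ.rep h v := by
  simp [sumMap, LinearMap.sum_apply]

/-- The expectation of `⟨v, ρ(y) v⟩` at a random fixed vector of `H` is a normalized trace, which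
is computed from the character on the coset `yH`. -/
theorem UnitaryIrrep.finrank_mul_integral_inner (σ : UnitaryIrrep G) (H : Subgroup G) [Fintype H]
    (y : G) :
    (Nat.card H : ℂ) * Module.finrank ℂ (σ.fixedSpace H) *
        ∫ v : σ.fixedSpace H, inner ℂ (v : σ.Space) (σ.rep y v) ∂(uniformUnit (σ.fixedSpace H)) =
      ∑ h : H, σ.character (y * h) := by
  set W := σ.fixedSpace H
  have htr : LinearMap.trace ℂ W (σ.sumMap H ∘ₗ (σ.rep y ∘ₗ W.subtype)) =
      ∑ h : H, σ.character (y * h) := by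
    rw [LinearMap.trace_comp_comm', LinearMap.comp_assoc]
    have : W.subtype ∘ₗ σ.sumMap H = ∑ h : H, σ.rep h := by
      ext1 v
      simp [UnitaryIrrep.coe_sumMap, LinearMap.sum_apply, W]
    rw [this]
    have h2 : σ.rep y ∘ₗ ∑ h : H, σ.rep h = ∑ h : H, σ.rep (y * h) := by
      ext1 v
      simp [LinearMap.sum_apply]
    rw [h2, map_sum]
    rfl
  have hinner : ∀ v : W, inner ℂ v ((σ.sumMap H ∘ₗ (σ.rep y ∘ₗ W.subtype)) v) =
      (Nat.card H : ℂ) * inner ℂ (v : σ.Space) (σ.rep y v) := fun v => by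
    rw [Submodule.coe_inner]
    simp only [LinearMap.comp_apply, Submodule.subtype_apply]
    rw [UnitaryIrrep.coe_sumMap, inner_sum]
    have hterm : ∀ h : H, inner ℂ (v : σ.Space) (σ.rep h (σ.rep y v)) =
        inner ℂ (v : σ.Space) (σ.rep y v) := fun h => by
      conv_lhs => rw [← inner_map_map σ.rep σ.norm_map (h : G)⁻¹,
        UnitaryIrrep.mem_fixedSpace.1 v.2 _ (inv_mem h.2), σ.rep.inv_self_apply]
    simp [hterm]
  rw [← htr]
  rcases subsingleton_or_nontrivial W with hW | hW
  · rw [Subsingleton.elim (σ.sumMap H ∘ₗ (σ.rep y ∘ₗ W.subtype)) 0, map_zero,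
      Module.finrank_zero_of_subsingleton]
    simp
  · generalize σ.sumMap H ∘ₗ (σ.rep y ∘ₗ W.subtype) = T at hinner ⊢
    have hT := finrank_mul_integral_inner_apply (W := W) T
    simp only [hinner, integral_const_mul] at hT
    rw [mul_comm (Nat.card H : ℂ), mul_assoc]
    exact hT

/-- The probability with which Alice chooses a given irreducible representation. -/
def weight (σ : UnitaryIrrep G) (H : Subgroup G) : ℝ :=
  (Nat.card H * σ.dim * Module.finrank ℂ (σ.fixedSpace H) : ℕ) / (Nat.card G : ℝ)

open Classical in
/-- Averaged over Alice's choices, `⟨v, ρ(y) v⟩` is the indicator function of `H`: this is the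
decomposition of the regular character, summed over the coset `yH`. -/
theorem sum_weight_mul_integral [Finite G] [Fintype (Irr G)] {R : Irr G → UnitaryIrrep G}
    (hR : IsRepresentatives R) (H : Subgroup G) (y : G) :
    ∑ i, (weight (R i) H : ℂ) * ∫ v : (R i).fixedSpace H,
        inner ℂ (v : (R i).Space) ((R i).rep y v) ∂(uniformUnit ((R i).fixedSpace H)) =
      if y ∈ H then 1 else 0 := by
  have := Fintype.ofFinite H
  have hG : (Nat.card G : ℂ) ≠ 0 := Nat.cast_ne_zero.2 Nat.card_pos.ne'
  have hterm : ∀ i, (weight (R i) H : ℂ) * ∫ v : (R i).fixedSpace H,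
        inner ℂ (v : (R i).Space) ((R i).rep y v) ∂(uniformUnit ((R i).fixedSpace H)) =
      (Nat.card G : ℂ)⁻¹ * ∑ h : H, ((R i).dim : ℂ) * (R i).character (y * h) := fun i => by
    rw [← Finset.mul_sum, ← UnitaryIrrep.finrank_mul_integral_inner, weight]
    push_cast
    ring
  simp only [hterm]
  rw [← Finset.mul_sum, Finset.sum_comm]
  simp only [sum_dim_mul_character hR]
  rw [Finset.sum_ite, Finset.sum_const_zero, add_zero, Finset.sum_const, nsmul_eq_mul]
  have hcard : (Finset.univ.filter fun h : H => y * h = 1).card = if y ∈ H then 1 else 0 := by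
    split_ifs with hy
    · refine Finset.card_eq_one.2 ⟨⟨y⁻¹, inv_mem hy⟩, ?_⟩
      ext h
      simp only [Finset.mem_filter, Finset.mem_univ, true_and, Finset.mem_singleton,
        Subtype.ext_iff]
      rw [mul_eq_one_iff_inv_eq, eq_comm]
    · refine Finset.card_eq_zero.2 (Finset.filter_eq_empty_iff.2 fun h _ hh => hy ?_)
      rw [eq_inv_of_mul_eq_one_left hh]
      exact inv_mem h.2
  rw [hcard]
  split_ifs <;> simp [hG]

theorem weight_nonneg (σ : UnitaryIrrep G) (H : Subgroup G) : 0 ≤ weight σ H := by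
  unfold weight; positivity

theorem weight_eq_zero (σ : UnitaryIrrep G) (H : Subgroup G) [Subsingleton (σ.fixedSpace H)] :
    weight σ H = 0 := by
  simp [weight, Module.finrank_zero_of_subsingleton]

theorem sum_weight [Finite G] [Fintype (Irr G)] {R : Irr G → UnitaryIrrep G}
    (hR : IsRepresentatives R) (H : Subgroup G) : ∑ i, weight (R i) H = 1 := by
  have h := sum_weight_mul_integral hR H 1
  rw [if_pos H.one_mem] at h
  rw [← Complex.ofReal_inj, Complex.ofReal_sum, Complex.ofReal_one, ← h]
  refine Finset.sum_congr rfl fun i _ => ?_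
  rcases subsingleton_or_nontrivial ((R i).fixedSpace H) with hW | hW
  · simp [weight_eq_zero]
  · rw [integral_congr_ae (g := fun _ => (1 : ℂ))]
    · simp
    · filter_upwards [ae_norm_eq_one_uniformUnit (W := (R i).fixedSpace H)] with v hv
      rw [map_one, Module.End.one_apply, inner_self_eq_norm_sq_to_K, ← Submodule.coe_norm, hv]
      simp

end Expectation

/-! ### Correctness of the protocol -/

section Correctness

variable {G : Type*} [Group G] {R : Irr G → UnitaryIrrep G} {ε : ℝ} {c : ℕ}

/-- Alice's message as a function of the random vector, once the representation is chosen. -/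
def Setup.message (S : Setup R ε c) (H : Subgroup G) (i : Irr G) (v : (R i).fixedSpace H) :
    Fin c → Bool :=
  S.encode ⟨i, S.near i (v : (R i).Space)⟩

theorem Setup.measurable_message (S : Setup R ε c) (H : Subgroup G) (i : Irr G) :
    Measurable (S.message H i) := by
  have h : Measurable fun n : {n : (R i).Space // n ∈ S.net i} => S.encode ⟨i, n⟩ :=
    measurable_of_finite _
  exact h.comp ((S.measurable_near i).comp measurable_subtype_coe)

theorem ofReal_weight [Finite G] (σ : UnitaryIrrep G) (H : Subgroup G) :
    ((Nat.card H * σ.dim * Module.finrank ℂ (σ.fixedSpace H) : ℕ) : ENNReal)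
        / (Nat.card G : ENNReal) = ENNReal.ofReal (weight σ H) := by
  rw [weight, ENNReal.ofReal_div_of_pos (Nat.cast_pos.2 Nat.card_pos), ENNReal.ofReal_natCast,
    ENNReal.ofReal_natCast]

theorem Setup.alice_real [Finite G] [Fintype (Irr G)] (S : Setup R ε c) (H : Subgroup G)
    (A : Set (Fin c → Bool)) :
    (S.alice H).real A =
      ∑ i, weight (R i) H * (uniformUnit ((R i).fixedSpace H)).real (S.message H i ⁻¹' A) := by
  have hA : MeasurableSet A := A.toFinite.measurableSet
  rw [measureReal_def, Setup.alice, Measure.sum_apply _ hA, tsum_fintype]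
  have hterm : ∀ i, (((((Nat.card H * (R i).dim * Module.finrank ℂ ((R i).fixedSpace H) : ℕ) :
      ENNReal) / (Nat.card G : ENNReal)) • Measure.map
        (fun v : (R i).fixedSpace H => S.encode ⟨i, S.near i (v : (R i).Space)⟩)
        (uniformUnit ((R i).fixedSpace H))) A) =
      ENNReal.ofReal (weight (R i) H) *
        uniformUnit ((R i).fixedSpace H) (S.message H i ⁻¹' A) := fun i => by
    rw [Measure.smul_apply, smul_eq_mul, ofReal_weight]
    exact congrArg _ (Measure.map_apply (S.measurable_message H i) hA)
  simp only [hterm]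
  rw [ENNReal.toReal_sum]
  · refine Finset.sum_congr rfl fun i _ => ?_
    rw [ENNReal.toReal_mul, ENNReal.toReal_ofReal (weight_nonneg _ _), measureReal_def]
  · intro i _
    rcases subsingleton_or_nontrivial ((R i).fixedSpace H) with hW | hW
    · simp [weight_eq_zero]
    · exact ENNReal.mul_ne_top ENNReal.ofReal_ne_top (measure_ne_top _ _)

theorem Setup.alice_real_eq_one [Finite G] (hR : IsRepresentatives R) (S : Setup R ε c)
    (H : Subgroup G) {A : Set (Fin c → Bool)}
    (hA : ∀ i, ∀ v : (R i).fixedSpace H, ‖v‖ = 1 → S.message H i v ∈ A) :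
    (S.alice H).real A = 1 := by
  have := Fintype.ofFinite (Irr G)
  rw [S.alice_real, ← sum_weight hR H]
  refine Finset.sum_congr rfl fun i _ => ?_
  rcases subsingleton_or_nontrivial ((R i).fixedSpace H) with hW | hW
  · simp [weight_eq_zero]
  · have hae : ∀ᵐ v ∂(uniformUnit ((R i).fixedSpace H)), v ∈ S.message H i ⁻¹' A :=
      ae_norm_eq_one_uniformUnit.mono fun v hv => hA i v hv
    rw [measureReal_def, (mem_ae_iff_prob_eq_one
      (S.measurable_message H i A.toFinite.measurableSet)).1 hae, ENNReal.toReal_one, mul_one]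

theorem Setup.isProbabilityMeasure_alice [Finite G] (hR : IsRepresentatives R)
    (S : Setup R ε c) (H : Subgroup G) : IsProbabilityMeasure (S.alice H) :=
  ⟨(ENNReal.toReal_eq_one_iff _).1
    (S.alice_real_eq_one hR H (A := Set.univ) fun _ _ _ => Set.mem_univ _)⟩

/-- Bob's decoding of a message is unambiguous. -/
theorem Setup.bob_message (S : Setup R ε c) (H : Subgroup G) (y : G) (i : Irr G)
    (v : (R i).fixedSpace H) :
    S.bob y (S.message H i v) = true ↔
      ‖(1 : ℂ) - inner ℂ ((R i).rep y (S.near i (v : (R i).Space) : (R i).Space))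
        (S.near i (v : (R i).Space) : (R i).Space)‖ ≤ 2 * ε := by
  classical
  rw [Setup.bob, decide_eq_true_iff, Setup.message]
  constructor
  · rintro ⟨j, n, he, hn⟩
    cases S.encode.injective he
    exact hn
  · exact fun h => ⟨i, _, rfl, h⟩

theorem Setup.near_spec (S : Setup R ε c) (i : Irr G) {v : (R i).Space} (hv : ‖v‖ = 1) :
    ‖(S.near i v : (R i).Space)‖ = 1 ∧
      1 - ε ^ 2 < ‖inner ℂ (S.near i v : (R i).Space) v‖ ^ 2 := by
  refine ⟨(S.isEpsNet i).unit _ (S.near i v).2, ?_⟩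
  obtain ⟨n, hn, h⟩ := (S.isEpsNet i).cover v hv
  exact h.trans_le (pow_le_pow_left₀ (norm_nonneg _) (S.near_closest i v hv n hn) 2)

/-- For one representation, Markov's inequality: on messages that Bob accepts, the real part of
`⟨v, ρ(y) v⟩` is at least `1 - 5 ε`, and it is never below `-1`. -/
theorem Setup.accept_le (S : Setup R ε c) (hε0 : 0 ≤ ε) (hε : ε ≤ 1) (H : Subgroup G) (y : G)
    (i : Irr G) [Nontrivial ((R i).fixedSpace H)] :
    (2 - 5 * ε) * (1 - (uniformUnit ((R i).fixedSpace H)).real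
        (S.message H i ⁻¹' {m | S.bob y m = false})) ≤
      1 + (∫ v : (R i).fixedSpace H, inner ℂ (v : (R i).Space) ((R i).rep y v)
        ∂(uniformUnit ((R i).fixedSpace H))).re := by
  set W := (R i).fixedSpace H
  set μ := uniformUnit W
  have hrej : MeasurableSet (S.message H i ⁻¹' {m | S.bob y m = false}) :=
    S.measurable_message H i (Set.toFinite _).measurableSet
  set A : Set W := (S.message H i ⁻¹' {m | S.bob y m = false})ᶜ with hA
  have hcont : Continuous fun v : W => inner ℂ (v : (R i).Space) ((R i).rep y v) :=
    continuous_subtype_val.inner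
      ((((R i).rep y).continuous_of_finiteDimensional).comp continuous_subtype_val)
  have hbound : ∀ v : W, ‖v‖ = 1 → ‖inner ℂ (v : (R i).Space) ((R i).rep y v)‖ ≤ 1 :=
    fun v hv => by
      have h := norm_inner_le_norm (𝕜 := ℂ) (v : (R i).Space) ((R i).rep y v)
      rwa [(R i).norm_map, ← Submodule.coe_norm, hv, one_mul] at h
  have hint := integrable_uniformUnit hcont 1 hbound
  have hintre : Integrable
      (fun v : W => (inner ℂ (v : (R i).Space) ((R i).rep y v)).re) μ := hint.re
  have hmono : ∫ v, A.indicator (fun _ => 2 - 5 * ε) v ∂μ ≤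
      ∫ v : W, (1 + (inner ℂ (v : (R i).Space) ((R i).rep y v)).re) ∂μ := by
    refine integral_mono_ae ((integrable_const _).indicator hrej.compl)
      ((integrable_const _).add hintre) ?_
    filter_upwards [ae_norm_eq_one_uniformUnit (W := W)] with v hv
    by_cases hvA : v ∈ A
    · rw [Set.indicator_of_mem hvA]
      have hacc : S.bob y (S.message H i v) = true := by
        simpa [hA] using hvA
      rw [S.bob_message] at hacc
      have hv' : ‖(v : (R i).Space)‖ = 1 := hv
      obtain ⟨hn, hnear⟩ := S.near_spec i hv'
      have h := norm_one_sub_inner_le_of_near (R i).rep (R i).norm_map hn hv' hε hε0 hnear hacc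
      have h2 := (Complex.abs_re_le_norm _).trans h
      rw [← inner_conj_symm, Complex.conj_re]
      rw [Complex.sub_re, Complex.one_re] at h2
      linarith [(abs_le.1 h2).2]
    · rw [Set.indicator_of_notMem hvA]
      linarith [(abs_le.1 ((Complex.abs_re_le_norm _).trans (hbound v hv))).1]
  rw [integral_indicator_const _ hrej.compl, probReal_compl_eq_one_sub hrej, smul_eq_mul,
    integral_add (integrable_const _) hintre, mul_comm] at hmono
  have hre : ∫ v : W, (inner ℂ (v : (R i).Space) ((R i).rep y v)).re ∂μ =
      (∫ v : W, inner ℂ (v : (R i).Space) ((R i).rep y v) ∂μ).re := integral_re hint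
  rw [hre] at hmono
  simpa using hmono

/-- Correctness holds for every `ε ≤ 1 / 10`: then Bob wrongly accepts with probability at most
`1 / (2 - 5 ε) ≤ 2 / 3`. -/
theorem Setup.computes [Finite G] (hR : IsRepresentatives R) (S : Setup R ε c) (hε0 : 0 ≤ ε)
    (hε : ε ≤ 1 / 10) : S.protocol.Computes (memb G) 0 (2 / 3) where
  isProbability H := S.isProbabilityMeasure_alice hR H
  complete H y hy := by
    have hyH : y ∈ H := by simpa [memb] using hy
    rw [sub_zero]
    refine (S.alice_real_eq_one hR H fun i v hv => ?_).ge
    have hv' : ‖(v : (R i).Space)‖ = 1 := hv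
    obtain ⟨hn, hnear⟩ := S.near_spec i hv'
    exact (S.bob_message H y i v).2 (norm_one_sub_inner_le_of_fixed (R i).rep (R i).norm_map hn hv'
      (UnitaryIrrep.mem_fixedSpace.1 v.2 y hyH) (by linarith) hε0 hnear)
  sound H y hy := by
    have := Fintype.ofFinite (Irr G)
    have hyH : y ∉ H := by simpa [memb] using hy
    change _ ≤ (S.alice H).real {m | S.bob y m = false}
    rw [S.alice_real]
    have hE := congrArg Complex.re (sum_weight_mul_integral hR H y)
    rw [if_neg hyH, Complex.re_sum, Complex.zero_re] at hE
    simp only [Complex.re_ofReal_mul] at hE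
    have hsum : ∑ i, weight (R i) H * ((2 - 5 * ε) * (1 - (uniformUnit ((R i).fixedSpace H)).real
        (S.message H i ⁻¹' {m | S.bob y m = false}))) ≤
      ∑ i, weight (R i) H * (1 + (∫ v : (R i).fixedSpace H,
        inner ℂ (v : (R i).Space) ((R i).rep y v) ∂(uniformUnit ((R i).fixedSpace H))).re) := by
      refine Finset.sum_le_sum fun i _ => ?_
      rcases subsingleton_or_nontrivial ((R i).fixedSpace H) with hW | hW
      · simp [weight_eq_zero]
      · exact mul_le_mul_of_nonneg_left (S.accept_le hε0 (by linarith) H y i) (weight_nonneg _ _)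
    have hlhs : ∀ r : Irr G → ℝ, ∑ i, weight (R i) H * ((2 - 5 * ε) * (1 - r i)) =
        (2 - 5 * ε) * (1 - ∑ i, weight (R i) H * r i) := fun r => by
      have hi : ∀ i, weight (R i) H * ((2 - 5 * ε) * (1 - r i)) =
          (2 - 5 * ε) * (weight (R i) H - weight (R i) H * r i) := fun i => by ring
      simp only [hi, ← Finset.mul_sum, Finset.sum_sub_distrib, sum_weight hR]
    rw [hlhs] at hsum
    simp only [mul_add, mul_one, Finset.sum_add_distrib, hE, sum_weight hR, add_zero] at hsum
    have hnn : 0 ≤ ∑ i, weight (R i) H * (uniformUnit ((R i).fixedSpace H)).real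
        (S.message H i ⁻¹' {m | S.bob y m = false}) :=
      Finset.sum_nonneg fun i _ => mul_nonneg (weight_nonneg _ _) measureReal_nonneg
    nlinarith

end Correctness

/-! ### Nets and the length of the messages -/

section Nets

theorem norm_sub_sq_le_of_floor_eq {d M : ℕ} {w n : EuclideanSpace ℂ (Fin d)}
    (hre : ∀ i, ⌊(M : ℝ) * (w i).re⌋ = ⌊(M : ℝ) * (n i).re⌋)
    (him : ∀ i, ⌊(M : ℝ) * (w i).im⌋ = ⌊(M : ℝ) * (n i).im⌋) :
    (M : ℝ) ^ 2 * ‖n - w‖ ^ 2 ≤ 2 * d := by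
  have hfloor : ∀ {a b : ℝ}, ⌊(M : ℝ) * a⌋ = ⌊(M : ℝ) * b⌋ → (M : ℝ) ^ 2 * (b - a) ^ 2 ≤ 1 := by
    intro a b h
    have h1 := (abs_lt.1 (Int.abs_sub_lt_one_of_floor_eq_floor h))
    nlinarith
  rw [EuclideanSpace.norm_sq_eq, Finset.mul_sum]
  have hterm : ∀ i, (M : ℝ) ^ 2 * ‖(n - w) i‖ ^ 2 ≤ 2 := fun i => by
    have h1 := hfloor (hre i)
    have h2 := hfloor (him i)
    rw [Complex.sq_norm, Complex.normSq_apply, PiLp.sub_apply, Complex.sub_re, Complex.sub_im]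
    nlinarith
  calc ∑ i, (M : ℝ) ^ 2 * ‖(n - w) i‖ ^ 2 ≤ ∑ _i : Fin d, (2 : ℝ) :=
        Finset.sum_le_sum fun i _ => hterm i
    _ = 2 * d := by simp [mul_comm]

theorem one_sub_sq_lt_of_norm_sub_sq_lt {V : Type*} [NormedAddCommGroup V]
    [InnerProductSpace ℂ V] {n w : V} (hn : ‖n‖ = 1) (hw : ‖w‖ = 1) {ε : ℝ}
    (h : ‖n - w‖ ^ 2 < ε ^ 2) : 1 - ε ^ 2 < ‖inner ℂ n w‖ ^ 2 := by
  have h1 := norm_sub_sq (𝕜 := ℂ) n w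
  rw [hn, hw] at h1
  have h2 := Complex.abs_re_le_norm (inner ℂ n w)
  have h3 : (inner ℂ n w).re ^ 2 ≤ ‖inner ℂ n w‖ ^ 2 := sq_le_sq' (abs_le.1 h2).1 (abs_le.1 h2).2
  change _ = 1 ^ 2 - 2 * (inner ℂ n w).re + 1 ^ 2 at h1
  nlinarith [sq_nonneg ((inner ℂ n w).re - 1)]

/-- A net from one unit vector out of every cell of a grid of mesh `1 / M` that contains one. -/
theorem exists_isEpsNet_card_le (d M : ℕ) {ε : ℝ} (h : 2 * (d : ℝ) < ε ^ 2 * (M : ℝ) ^ 2) :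
    ∃ N : Finset (EuclideanSpace ℂ (Fin d)), IsEpsNet ε N ∧ N.card ≤ (2 * M + 1) ^ (2 * d) := by
  classical
  let cell : EuclideanSpace ℂ (Fin d) → Fin d → ℤ × ℤ := fun w i =>
    (⌊(M : ℝ) * (w i).re⌋, ⌊(M : ℝ) * (w i).im⌋)
  let Q : Finset (Fin d → ℤ × ℤ) :=
    Fintype.piFinset fun _ => Finset.Icc (-(M : ℤ)) M ×ˢ Finset.Icc (-(M : ℤ)) M
  have hQ : Q.card = (2 * M + 1) ^ (2 * d) := by
    simp only [Q, Fintype.card_piFinset, Finset.card_product, Int.card_Icc, Finset.prod_const,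
      Finset.card_univ, Fintype.card_fin]
    rw [show ((M : ℤ) + 1 - -(M : ℤ)).toNat = 2 * M + 1 by omega, ← sq, ← pow_mul]
  have hfloor : ∀ a : ℝ, |a| ≤ 1 → ⌊(M : ℝ) * a⌋ ∈ Finset.Icc (-(M : ℤ)) M := fun a ha => by
    have hM : (0 : ℝ) ≤ M := Nat.cast_nonneg M
    rw [Finset.mem_Icc, Int.le_floor]
    refine ⟨by push_cast; nlinarith [(abs_le.1 ha).1], ?_⟩
    have : ((⌊(M : ℝ) * a⌋ : ℤ) : ℝ) ≤ (M : ℤ) :=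
      (Int.floor_le _).trans (by push_cast; nlinarith [(abs_le.1 ha).2])
    exact_mod_cast this
  have hcell : ∀ w : EuclideanSpace ℂ (Fin d), ‖w‖ = 1 → cell w ∈ Q := fun w hw => by
    refine Fintype.mem_piFinset.2 fun i => Finset.mem_product.2 ?_
    have hi : ‖w i‖ ≤ 1 := hw ▸ PiLp.norm_apply_le w i
    exact ⟨hfloor _ ((Complex.abs_re_le_norm _).trans hi),
      hfloor _ ((Complex.abs_im_le_norm _).trans hi)⟩
  let Qne := Q.filter fun q => ∃ w, ‖w‖ = 1 ∧ cell w = q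
  have hex : ∀ q : Qne, ∃ w, ‖w‖ = 1 ∧ cell w = q := fun q => (Finset.mem_filter.1 q.2).2
  choose rep hrep1 hrep2 using hex
  refine ⟨Finset.univ.image rep, ⟨?_, fun w hw => ?_⟩, ?_⟩
  · simp only [Finset.mem_image, Finset.mem_univ, true_and, forall_exists_index]
    rintro _ q rfl
    exact hrep1 q
  · let q : Qne := ⟨cell w, Finset.mem_filter.2 ⟨hcell w hw, w, hw, rfl⟩⟩
    refine ⟨rep q, Finset.mem_image_of_mem _ (Finset.mem_univ _),
      one_sub_sq_lt_of_norm_sub_sq_lt (hrep1 q) hw ?_⟩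
    have hq : ∀ i, cell w i = cell (rep q) i := fun i => (congrFun (hrep2 q) i).symm
    have hle := norm_sub_sq_le_of_floor_eq (fun i => congrArg Prod.fst (hq i))
      fun i => congrArg Prod.snd (hq i)
    have hM : (0 : ℝ) ≤ (M : ℝ) ^ 2 := sq_nonneg _
    nlinarith
  · refine Finset.card_image_le.trans ?_
    rw [Finset.card_univ, Fintype.card_coe, ← hQ]
    exact Finset.card_filter_le _ _

/-- In dimension at most `1`, all unit vectors agree up to a phase, so that one of them is a
net. -/
theorem exists_isEpsNet_card_le_one {d : ℕ} (hd : d ≤ 1) {ε : ℝ} (hε : 0 < ε) :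
    ∃ N : Finset (EuclideanSpace ℂ (Fin d)), IsEpsNet ε N ∧ N.card ≤ 1 := by
  interval_cases d
  · refine ⟨∅, ⟨by simp, fun w hw => ?_⟩, by simp⟩
    rw [Subsingleton.elim w 0, norm_zero] at hw
    exact absurd hw zero_ne_one
  · refine ⟨{EuclideanSpace.single 0 1}, ⟨by simp, fun w hw => ⟨_, Finset.mem_singleton_self _, ?_⟩⟩,
      by simp⟩
    have h : ‖w‖ ^ 2 = ‖w 0‖ ^ 2 := by simp [EuclideanSpace.norm_sq_eq]
    rw [EuclideanSpace.inner_single_left, map_one, one_mul, ← h, hw]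
    nlinarith

/-- Among finitely many vectors, one that is closest to a given vector can be found measurably:
compare them one after the other. -/
theorem exists_measurable_near {d : ℕ} {N : Finset (EuclideanSpace ℂ (Fin d))}
    (hN : N.Nonempty) :
    ∃ f : EuclideanSpace ℂ (Fin d) → {n // n ∈ N}, Measurable f ∧
      ∀ v, ∀ n ∈ N, ‖inner ℂ n v‖ ≤ ‖inner ℂ (f v : EuclideanSpace ℂ (Fin d)) v‖ := by
  classical
  suffices h : ∃ f : EuclideanSpace ℂ (Fin d) → EuclideanSpace ℂ (Fin d), Measurable f ∧
      (∀ v, f v ∈ N) ∧ ∀ v, ∀ n ∈ N, ‖inner ℂ n v‖ ≤ ‖inner ℂ (f v) v‖ by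
    obtain ⟨f, hf, hfN, hmax⟩ := h
    exact ⟨fun v => ⟨f v, hfN v⟩, hf.subtype_mk, hmax⟩
  induction hN using Finset.Nonempty.cons_induction with
  | singleton a => exact ⟨fun _ => a, measurable_const, by simp, by simp⟩
  | cons a N _ _ ih =>
    obtain ⟨f, hf, hfN, hmax⟩ := ih
    refine ⟨fun v => if ‖inner ℂ (f v) v‖ ≤ ‖inner ℂ a v‖ then a else f v, ?_, fun v => ?_,
      fun v n hn => ?_⟩
    · refine Measurable.ite (measurableSet_le ?_ ?_) measurable_const hf
      · exact (hf.inner measurable_id).norm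
      · exact (measurable_const.inner measurable_id).norm
    · beta_reduce
      split_ifs
      · exact Finset.mem_cons_self a N
      · exact Finset.mem_cons_of_mem (hfN v)
    · beta_reduce
      rcases Finset.mem_cons.1 hn with rfl | hn
      · split_ifs with h
        · exact le_rfl
        · exact (not_le.1 h).le
      · split_ifs with h
        · exact (hmax v n hn).trans h
        · exact hmax v n hn

variable {G : Type*} [Group G]

theorem nonempty_setup {R : Irr G → UnitaryIrrep G} {ε : ℝ} {c : ℕ} [Fintype (Irr G)]
    (net : (i : Irr G) → Finset (R i).Space) (hnet : ∀ i, IsEpsNet ε (net i))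
    (hc : ∑ i, (net i).card ≤ 2 ^ c) : Nonempty (Setup R ε c) := by
  have hne : ∀ i, (net i).Nonempty := fun i => by
    have := ((isIrreducible_iff (R i).rep).1 (R i).irreducible).1
    obtain ⟨w, hw⟩ := exists_norm_eq (R i).Space zero_le_one
    obtain ⟨n, hn, -⟩ := (hnet i).cover w hw
    exact ⟨n, hn⟩
  choose near hmeas hnear using fun i => exists_measurable_near (hne i)
  have hcard : Fintype.card ((i : Irr G) × {n : (R i).Space // n ∈ net i}) ≤
      Fintype.card (Fin c → Bool) := by
    simpa [Fintype.card_sigma] using hc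
  obtain ⟨e⟩ := Function.Embedding.nonempty_of_card_le hcard
  exact ⟨⟨net, hnet, near, hmeas, fun i v _ n hn => hnear i v n hn, e⟩⟩

theorem exists_net_card_le_card_pow [Finite G] (hG : 2 ≤ Nat.card G) (σ : UnitaryIrrep G) :
    ∃ N : Finset σ.Space, IsEpsNet (1 / ((10 * Nat.card G : ℕ) : ℝ)) N ∧
      N.card ≤ Nat.card G ^ (14 * dMax G) := by
  have hd := σ.dim_le_card
  have hD := σ.dim_le_dMax
  set n := Nat.card G
  have hn : (2 : ℝ) ≤ n := by exact_mod_cast hG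
  -- the mesh is chosen so that `2 d ≤ 2 n < (15 n ^ 2) ^ 2 / (10 n) ^ 2`
  obtain ⟨N, hN, hcard⟩ := exists_isEpsNet_card_le σ.dim (15 * n ^ 2)
    (ε := 1 / ((10 * n : ℕ) : ℝ)) (by
      have hd' : (σ.dim : ℝ) ≤ n := by exact_mod_cast hd
      push_cast
      rw [one_div, inv_pow, inv_mul_eq_div, lt_div_iff₀ (by positivity)]
      nlinarith [pow_pos (show (0 : ℝ) < n by linarith) 3,
        mul_le_mul_of_nonneg_right hd' (sq_nonneg (n : ℝ))])
  refine ⟨N, hN, hcard.trans ?_⟩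
  have hbase : 2 * (15 * n ^ 2) + 1 ≤ n ^ 7 := by
    have h5 : 2 ^ 5 ≤ n ^ 5 := Nat.pow_le_pow_left hG 5
    have h2 : 2 ^ 2 ≤ n ^ 2 := Nat.pow_le_pow_left hG 2
    rw [show n ^ 7 = n ^ 5 * n ^ 2 by ring]
    nlinarith
  calc (2 * (15 * n ^ 2) + 1) ^ (2 * σ.dim) ≤ (n ^ 7) ^ (2 * σ.dim) :=
        Nat.pow_le_pow_left hbase _
    _ = n ^ (14 * σ.dim) := by rw [← pow_mul]; congr 1; ring
    _ ≤ n ^ (14 * dMax G) := Nat.pow_le_pow_right (by omega) (by omega)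

/-- The choice of nets and encoding with short messages. For the trivial group, the bound forces
messages of length `0`, which the nets of size `1` in dimension `1` make possible. -/
theorem exists_setup [Finite G] (R : Irr G → UnitaryIrrep G) :
    ∃ c : ℕ, (c : ℝ) ≤ 30 * (dMax G : ℝ) * Real.logb 2 (Nat.card G : ℝ) ∧
      Nonempty (Setup R (1 / ((10 * Nat.card G : ℕ) : ℝ)) c) := by
  have := Fintype.ofFinite (Irr G)
  have hpos : 0 < Nat.card G := Nat.card_pos
  have hirr : Fintype.card (Irr G) ≤ Nat.card G := by
    rw [← Nat.card_eq_fintype_card]; exact card_irr_le G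
  rcases (show Nat.card G = 1 ∨ 2 ≤ Nat.card G by omega) with h1 | h2
  · refine ⟨0, by simp [h1], ?_⟩
    choose net hnet hcard using fun i => exists_isEpsNet_card_le_one
      ((R i).dim_le_card.trans h1.le) (ε := 1 / ((10 * Nat.card G : ℕ) : ℝ)) (by positivity)
    refine nonempty_setup net hnet ((Finset.sum_le_card_nsmul _ _ 1 fun i _ => hcard i).trans ?_)
    simpa [h1] using hirr
  · choose net hnet hcard using fun i => exists_net_card_le_card_pow h2 (R i)
    refine ⟨15 * dMax G * (Nat.log 2 (Nat.card G) + 1), ?_, nonempty_setup net hnet ?_⟩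
    · have hlog : (Nat.log 2 (Nat.card G) : ℝ) ≤ Real.logb 2 (Nat.card G : ℝ) := by
        exact_mod_cast Real.natLog_le_logb (Nat.card G) 2
      have hlog1 : (1 : ℝ) ≤ Nat.log 2 (Nat.card G) := by
        exact_mod_cast Nat.log_pos one_lt_two h2
      have hD : (0 : ℝ) ≤ dMax G := Nat.cast_nonneg _
      push_cast
      calc 15 * (dMax G : ℝ) * (Nat.log 2 (Nat.card G) + 1)
          ≤ 15 * (dMax G : ℝ) * (2 * Real.logb 2 (Nat.card G : ℝ)) := by gcongr; linarith
        _ = 30 * (dMax G : ℝ) * Real.logb 2 (Nat.card G : ℝ) := by ring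
    · rcases isEmpty_or_nonempty (Irr G) with hI | ⟨⟨i⟩⟩
      · simp
      have hD : 1 ≤ dMax G := (R i).dim_pos.trans_le (R i).dim_le_dMax
      calc ∑ i, (net i).card ≤ Fintype.card (Irr G) * Nat.card G ^ (14 * dMax G) := by
            simpa using Finset.sum_le_card_nsmul Finset.univ _ _ fun i _ => hcard i
        _ ≤ Nat.card G ^ (dMax G) * Nat.card G ^ (14 * dMax G) :=
            Nat.mul_le_mul_right _ (hirr.trans (Nat.le_self_pow (by omega) _))
        _ = Nat.card G ^ (15 * dMax G) := by rw [← pow_add]; congr 1; ring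
        _ ≤ (2 ^ (Nat.log 2 (Nat.card G) + 1)) ^ (15 * dMax G) :=
            Nat.pow_le_pow_left (Nat.lt_pow_succ_log_self one_lt_two _).le _
        _ = 2 ^ (15 * dMax G * (Nat.log 2 (Nat.card G) + 1)) := by
            rw [← pow_mul, mul_comm]

end Nets

end CompRep

end

theorem mainTheorem1 :
    ∃ (C δ : ℝ) (p : Polynomial ℕ), 0 < C ∧ 0 < δ ∧ δ < 1 ∧
      ∀ (G : Type*) [Group G] [Finite G], ∃ ε : ℝ,
        0 < ε ∧ ε = 1 / ((p.eval (Nat.card G) : ℕ) : ℝ) ∧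
        ∀ R : CompRep.Irr G → CompRep.UnitaryIrrep G, CompRep.IsRepresentatives R →
          (∃ c : ℕ, (c : ℝ) ≤ C * (CompRep.dMax G : ℝ) * Real.logb 2 (Nat.card G : ℝ) ∧
            Nonempty (CompRep.Setup R ε c)) ∧
          ∀ (c : ℕ) (S : CompRep.Setup R ε c),
            S.protocol.Computes (CompRep.memb G) 0 δ := by
  refine ⟨30, 2 / 3, 10 * Polynomial.X, by norm_num, by norm_num, by norm_num, fun G _ _ =>
    ⟨1 / ((10 * Nat.card G : ℕ) : ℝ), ?_, by simp, fun R hR =>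
      ⟨CompRep.exists_setup R, fun c S => S.computes hR (by positivity) ?_⟩⟩⟩
  · have : 0 < Nat.card G := Nat.card_pos
    positivity
  · have : (1 : ℝ) ≤ Nat.card G := by exact_mod_cast (Nat.card_pos : 0 < Nat.card G)
    push_cast
    exact one_div_le_one_div_of_le (by norm_num) (by linarith)
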